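/- Let $G=(V,E)$ be a finite simple graph (possibly disconnected, possibly without edges), and let $$\mathcal P_G=\operatorname{conv}\{\pm(e_i-e_j) : ij\in E\}\subset\mathbb R^V$$ be its symmetric edge polytope, with $d=\dim\mathcal P_G$. Let $(h^*_0,\dots,h^*_d)$ be the $h^*$-vector of $\mathcal P_G$, defined by $$\sum_{k\ge 0}|k\mathcal P_G\cap\mathbb Z^V|\,t^k=\frac{h^*_0+h^*_1t+\cdots+h^*_dt^d}{(1-t)^{d+1}},$$ and let $\gamma(\mathcal P_G)=(\gamma_0,\dots,\gamma_{\lfloor d/2\rfloor})$ be its $\gamma$-vector, defined (as the $h^*$-vector is palindromic) by $$\sum_{i=0}^{\lfloor d/2\rfloor}\gamma_i\,t^i(1+t)^{d-2i}=\sum_{j=0}^{d}h^*_jt^j,$$ with the convention $\gamma_2=0$ if $d<4$ (and if $E=\emptyset$, where $\mathcal P_G=\emptyset$). Then $\gamma_2(\mathcal P_G)\ge 0$. -/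

import Mathlib

open scoped Pointwise

/-- The symmetric edge polytope of a graph `G` with vertex set `V`: the convex hull in `ℝ^V` of
the points `± (e_i - e_j)` for the edges `ij` of `G`. Adjacency is symmetric, so both signs occur
in the set below. -/
def symmetricEdgePolytope {V : Type*} [DecidableEq V] (G : SimpleGraph V) : Set (V → ℝ) :=
  convexHull ℝ {x | ∃ i j : V, G.Adj i j ∧ x = Pi.single i 1 - Pi.single j 1}

/-- The dimension of (the affine hull of) a set of points in `ℝ^V`. -/
noncomputable def polytopeDim {V : Type*} (P : Set (V → ℝ)) : ℕ :=
  Module.finrank ℝ (vectorSpan ℝ P)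

/-- The Ehrhart counting function: the number `|k P ∩ ℤ^V|` of lattice points in the `k`-th
dilation of `P`. -/
noncomputable def ehrhartCount {V : Type*} (P : Set (V → ℝ)) (k : ℕ) : ℕ :=
  Nat.card {x : V → ℤ // (fun v => (x v : ℝ)) ∈ (k : ℝ) • P}

/-- The `h^*`-series `(1 - t)^(d+1) * ∑_k L(k) t^k` attached to a counting function `L` in
dimension `d`. -/
noncomputable def hStarSeries (d : ℕ) (L : ℕ → ℕ) : PowerSeries ℤ :=
  (1 - PowerSeries.X) ^ (d + 1) * PowerSeries.mk fun k => (L k : ℤ)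

/-- The entry `h^*_j(P)` of the `h^*`-vector of a lattice polytope `P`. -/
noncomputable def hStar {V : Type*} (P : Set (V → ℝ)) (j : ℕ) : ℤ :=
  PowerSeries.coeff j (hStarSeries (polytopeDim P) (ehrhartCount P))

/-- The `γ`-vector of a symmetric vector `(h_0, …, h_d)`, that is, the solution of
`∑_{i ≤ d/2} γ_i t^i (1 + t)^(d - 2 i) = ∑_{j ≤ d} h_j t^j`, obtained by comparing the
coefficients of `t^k` for `k ≤ d/2`; entries with index larger than `d/2` are `0`. -/
def gammaOf (d : ℕ) (h : ℕ → ℤ) (k : ℕ) : ℤ :=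
  if 2 * k ≤ d then
    h k - ∑ i : Fin k, gammaOf d h i * ((d - 2 * (i : ℕ)).choose (k - (i : ℕ)) : ℤ)
  else 0
termination_by k
decreasing_by exact i.isLt

/-- The entry `γ_k(P)` of the `γ`-vector of the `h^*`-polynomial of `P`. -/
noncomputable def gammaVec {V : Type*} (P : Set (V → ℝ)) (k : ℕ) : ℤ :=
  gammaOf (polytopeDim P) (hStar P) k

/-- If `L(n) = ∑_{j ≤ d} h_j * binom(n + d - j, d)` for all `n`, then the coefficients of
`hStarSeries d L` are the numbers `h_j`. -/
theorem hStarSeries_eq_of_ehrhart (d : ℕ) (L : ℕ → ℕ) (h : ℕ → ℤ)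
    (hL : ∀ n, (L n : ℤ) = ∑ j ∈ Finset.range (d + 1), h j * ((n + d - j).choose d : ℤ)) :
    hStarSeries d L = ∑ j ∈ Finset.range (d + 1), PowerSeries.C (h j) * PowerSeries.X ^ j := by
  have key : (PowerSeries.mk fun k => (L k : ℤ)) =
      ∑ j ∈ Finset.range (d + 1), PowerSeries.C (h j) * (PowerSeries.X ^ j *
        PowerSeries.mk fun n => ((d + n).choose d : ℤ)) := by
    ext n
    simp only [PowerSeries.coeff_mk, map_sum, PowerSeries.coeff_C_mul,
      PowerSeries.coeff_X_pow_mul', hL]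
    refine Finset.sum_congr rfl fun j hj => ?_
    have hj' : j ≤ d := by simpa [Nat.lt_succ_iff] using hj
    split_ifs with hjn
    · rw [show n + d - j = d + (n - j) by omega]
    · rw [Nat.choose_eq_zero_of_lt (by omega)]; simp
  have one : (PowerSeries.mk fun n => ((d + n).choose d : ℤ)) *
      (1 - PowerSeries.X) ^ (d + 1) = 1 :=
    PowerSeries.mk_add_choose_mul_one_sub_pow_eq_one ℤ d
  rw [hStarSeries, key, Finset.mul_sum]
  refine Finset.sum_congr rfl fun j _ => ?_
  linear_combination (PowerSeries.C (h j) * PowerSeries.X ^ j) * one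

/-- A vector `γ` that satisfies the defining polynomial identity of the `γ`-vector of
`(h_0, …, h_d)` is given by `gammaOf`. -/
theorem gammaOf_eq_of_identity (d : ℕ) (h γ : ℕ → ℤ)
    (hγ : ∑ i ∈ Finset.range (d / 2 + 1),
        Polynomial.C (γ i) * (Polynomial.X ^ i * (1 + Polynomial.X) ^ (d - 2 * i)) =
      ∑ j ∈ Finset.range (d + 1), Polynomial.C (h j) * Polynomial.X ^ j)
    (k : ℕ) (hk : 2 * k ≤ d) : gammaOf d h k = γ k := by
  induction k using Nat.strong_induction_on with
  | _ k ih =>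
    have hc := congrArg (fun p => Polynomial.coeff p k) hγ
    simp only [Polynomial.finsetSum_coeff, Polynomial.coeff_C_mul, Polynomial.coeff_X_pow_mul',
      Polynomial.coeff_X_pow, Polynomial.coeff_one_add_X_pow] at hc
    have hr : ∑ j ∈ Finset.range (d + 1), h j * (if k = j then (1 : ℤ) else 0) = h k := by
      simp only [mul_ite, mul_one, mul_zero, Finset.sum_ite_eq, Finset.mem_range]
      rw [if_pos (by omega)]
    rw [hr] at hc
    have hsub : Finset.range (k + 1) ⊆ Finset.range (d / 2 + 1) :=
      Finset.range_subset_range.2 (by omega)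
    rw [← Finset.sum_subset hsub (by
      intro i _ hi
      have : ¬ i ≤ k := by simpa [Nat.lt_succ_iff] using hi
      rw [if_neg this, mul_zero]), Finset.sum_range_succ] at hc
    rw [gammaOf, if_pos hk]
    have hs : ∑ i : Fin k, gammaOf d h i * ((d - 2 * (i : ℕ)).choose (k - (i : ℕ)) : ℤ) =
        ∑ i ∈ Finset.range k,
          γ i * (if i ≤ k then ((d - 2 * i).choose (k - i) : ℤ) else 0) := by
      rw [← Fin.sum_univ_eq_sum_range
        (fun i => γ i * (if i ≤ k then ((d - 2 * i).choose (k - i) : ℤ) else 0)) k]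
      refine Finset.sum_congr rfl fun i _ => ?_
      rw [ih i i.isLt (by have := i.isLt; omega), if_pos i.isLt.le]
    rw [hs]
    simp only [le_refl, if_true, Nat.sub_self, Nat.choose_zero_right, Nat.cast_one,
      mul_one] at hc
    linarith

/-! Let A consist of 0 and the vectors e_i - e_j over the edges, let m be the number of edges, r the
rank of the graphic matroid, g = m - r the cyclomatic number, and L the Ehrhart counting function.
For d ≥ 4, expanding the series gives γ_2 = L(2) - (2d - 1) L(1) + 2d² - 2d - 2. Since L(1) ≤ |A| ≤
2m + 1, L(2) ≥ |A + A| and d ≤ r, it suffices that |A + A| ≥ 2m² + 2m + 1 - 2g² - 4g, which is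
exactly what cancels the other terms when d = r.

This bound, `le_card_rootSet_add_rootSet`, is proved by deleting a vertex v at maximal distance from
a fixed vertex; its neighbours stay connected in H = G - v, so the rank drops by at most one. Let N
be the neighbourhood of v, k = |N|, and a_i the number of H-neighbours of i in N. Splitting the sums
by their v-coordinate (0, ±1, ±2) shows how many new ones v creates; the loss through coincidences
is governed by the sum of the binomials C(a_i, 2) (`card_add_le_card_add`).

Large a_i mean many edges of H meeting N, hence many cycles in H (`two_mul_edgeRank_le`), and g is
large enough to absorb the loss. The balance is `extremal_arith`, fed by the bound
`four_mul_sum_sq_le` on the squared degrees inside N. -/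

/-! ### Rank of the graphic matroid and vertex deletion -/

section

open Finset
open scoped Classical

variable {V : Type*} [DecidableEq V]

/-- The vectors `e_i - e_j` for the edges `ij` of `G` span this subspace of `ℝ^V`. -/
def edgeSpan (G : SimpleGraph V) : Submodule ℝ (V → ℝ) :=
  Submodule.span ℝ {x | ∃ i j : V, G.Adj i j ∧ x = Pi.single i 1 - Pi.single j 1}

/-- The rank of the graphic matroid of `G`. -/
noncomputable def edgeRank (G : SimpleGraph V) : ℕ := Module.finrank ℝ (edgeSpan G)

theorem single_sub_single_mem_edgeSpan {G : SimpleGraph V} {i j : V} (h : G.Adj i j) :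
    (Pi.single i 1 - Pi.single j 1 : V → ℝ) ∈ edgeSpan G :=
  Submodule.subset_span ⟨i, j, h, rfl⟩

variable [Fintype V]

theorem edgeRank_le_card_edgeFinset (G : SimpleGraph V) : edgeRank G ≤ #G.edgeFinset := by
  set f : Sym2 V → V → ℝ := fun s => Pi.single s.out.1 1 - Pi.single s.out.2 1 with hf
  have hle : edgeSpan G ≤ Submodule.span ℝ ((G.edgeFinset.image f : Finset (V → ℝ)) : Set _) := by
    refine Submodule.span_le.2 ?_
    rintro _ ⟨i, j, hij, rfl⟩
    have hmem : f s(i, j) ∈ Submodule.span ℝ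
        ((G.edgeFinset.image f : Finset (V → ℝ)) : Set (V → ℝ)) :=
      Submodule.subset_span (by
        rw [Finset.mem_coe]
        exact Finset.mem_image_of_mem f (by simpa using hij))
    have hout : s((s(i, j) : Sym2 V).out.1, (s(i, j) : Sym2 V).out.2) = s(i, j) :=
      Quot.out_eq _
    rcases Sym2.eq_iff.1 hout with ⟨h1, h2⟩ | ⟨h1, h2⟩
    · simpa [hf, h1, h2] using hmem
    · have := Submodule.neg_mem _ hmem
      simpa [hf, h1, h2] using this
  calc edgeRank G ≤ _ := Submodule.finrank_mono hle
    _ ≤ #(G.edgeFinset.image f) := finrank_span_finset_le_card _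
    _ ≤ _ := card_image_le

theorem edgeSpan_le_sup_of_star {G R : SimpleGraph V} {w : V} {U : Finset V}
    (h : ∀ i j, G.Adj i j → R.Adj i j ∨ (i ∈ U ∧ j ∈ U)) :
    edgeSpan G ≤ edgeSpan R ⊔ Submodule.span ℝ
      (((U.erase w).image fun u => (Pi.single u 1 - Pi.single w 1 : V → ℝ) : Finset (V → ℝ)) :
        Set (V → ℝ)) := by
  refine Submodule.span_le.2 ?_
  rintro _ ⟨i, j, hij, rfl⟩
  rcases h i j hij with hR | ⟨hi, hj⟩
  · exact Submodule.mem_sup_left (single_sub_single_mem_edgeSpan hR)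
  · have key : ∀ u ∈ U, (Pi.single u 1 - Pi.single w 1 : V → ℝ) ∈ Submodule.span ℝ
        (((U.erase w).image fun u => (Pi.single u 1 - Pi.single w 1 : V → ℝ) :
          Finset (V → ℝ)) : Set (V → ℝ)) := by
      intro u hu
      by_cases huw : u = w
      · simp [huw]
      · refine Submodule.subset_span ?_
        rw [Finset.mem_coe]
        exact Finset.mem_image_of_mem _ (Finset.mem_erase.2 ⟨huw, hu⟩)
    have := Submodule.sub_mem _ (key i hi) (key j hj)
    refine Submodule.mem_sup_right ?_
    simpa using this

/-- A star on `U` centred at one of its vertices spans all differences within `U` and has only |U| -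
1 edges. -/
theorem edgeRank_add_one_le {G R : SimpleGraph V} {U : Finset V} (hU : U.Nonempty)
    (h : ∀ i j, G.Adj i j → R.Adj i j ∨ (i ∈ U ∧ j ∈ U)) :
    edgeRank G + 1 ≤ edgeRank R + #U := by
  obtain ⟨w, hw⟩ := hU
  have h1 := Submodule.finrank_mono (edgeSpan_le_sup_of_star (w := w) h)
  have h2 := h1.trans (Submodule.finrank_add_le_finrank_add_finrank _ _)
  have h3 : Module.finrank ℝ (Submodule.span ℝ
      (((U.erase w).image fun u => (Pi.single u 1 - Pi.single w 1 : V → ℝ) : Finset (V → ℝ)) :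
        Set (V → ℝ))) ≤ #(U.erase w) :=
    (finrank_span_finset_le_card _).trans card_image_le
  have h4 := card_erase_add_one hw
  unfold edgeRank
  omega

theorem sum_degree_eq_sum_card_inter (H : SimpleGraph V) (N : Finset V) :
    ∑ x ∈ N, H.degree x = ∑ x, #(H.neighborFinset x ∩ N) := by
  have := Finset.sum_card_bipartiteAbove_eq_sum_card_bipartiteBelow (s := N) (t := univ)
    (fun x y => H.Adj x y)
  convert this using 2 with x _ x _
  · rw [← SimpleGraph.card_neighborFinset_eq_degree]
    congr 1; ext; simp [bipartiteAbove]
  · congr 1; ext y; simp [bipartiteBelow, H.adj_comm, and_comm]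

/-- A lower bound for the cyclomatic number of `H` by that of the subgraph formed by the edges
that meet `N`. -/
theorem two_mul_edgeRank_le (H : SimpleGraph V) {N : Finset V} (hN : N.Nonempty) :
    2 * edgeRank H + 2 + ∑ x ∈ N, #(H.neighborFinset x ∩ N) +
        2 * ∑ x ∈ Nᶜ, #(H.neighborFinset x ∩ N) ≤
      2 * #H.edgeFinset + 2 * #N + 2 * #{x ∈ Nᶜ | (H.neighborFinset x ∩ N).Nonempty} := by
  set X : Finset V := {x ∈ Nᶜ | (H.neighborFinset x ∩ N).Nonempty} with hX
  -- `R` keeps the edges of `H` that avoid `N`; every other edge lies inside `N ∪ X`. The rank of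
  -- `R` is then bounded by its number of edges.
  obtain ⟨R, hR⟩ : ∃ R : SimpleGraph V, ∀ x y, R.Adj x y ↔ H.Adj x y ∧ x ∉ N ∧ y ∉ N :=
    ⟨{ Adj := fun x y => H.Adj x y ∧ x ∉ N ∧ y ∉ N
       symm := ⟨fun x y h => ⟨h.1.symm, h.2.2, h.2.1⟩⟩
       loopless := ⟨fun x h => H.loopless.irrefl x h.1⟩ }, fun _ _ => Iff.rfl⟩
  have hrank := edgeRank_add_one_le (G := H) (R := R) (U := N ∪ X) (hN.mono subset_union_left) (by
    intro i j hij
    by_cases hi : i ∈ N <;> by_cases hj : j ∈ N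
    · exact Or.inr (by simp [hi, hj])
    · refine Or.inr ⟨by simp [hi], mem_union_right _ ?_⟩
      exact mem_filter.2 ⟨by simpa using hj, i, by simp [hi, hij.symm]⟩
    · refine Or.inr ⟨mem_union_right _ ?_, by simp [hj]⟩
      exact mem_filter.2 ⟨by simpa using hi, j, by simp [hj, hij]⟩
    · exact Or.inl ((hR i j).2 ⟨hij, hi, hj⟩))
  have hedge := edgeRank_le_card_edgeFinset R
  have hcard : #(N ∪ X) ≤ #N + #X := card_union_le _ _
  have hHsum := H.sum_degrees_eq_twice_card_edges
  have hRsum := R.sum_degrees_eq_twice_card_edges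
  rw [← sum_add_sum_compl N] at hHsum hRsum
  have hR0 : ∑ x ∈ N, R.degree x = 0 := by
    refine sum_eq_zero fun x hx => ?_
    rw [← SimpleGraph.card_neighborFinset_eq_degree, card_eq_zero]
    ext y; simp [hR, hx]
  have hcompl : ∑ x ∈ Nᶜ, H.degree x =
      ∑ x ∈ Nᶜ, R.degree x + ∑ x ∈ Nᶜ, #(H.neighborFinset x ∩ N) := by
    rw [← sum_add_distrib]
    refine sum_congr rfl fun x hx => ?_
    have hx' : x ∉ N := by simpa using hx
    rw [← SimpleGraph.card_neighborFinset_eq_degree, ← SimpleGraph.card_neighborFinset_eq_degree,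
      ← card_sdiff_add_card_inter _ N]
    congr 2
    ext y; simp [hR, hx']
  have hin := sum_degree_eq_sum_card_inter H N
  rw [← sum_add_sum_compl N (fun x => #(H.neighborFinset x ∩ N))] at hin
  omega

/-- A vertex of maximal distance from a fixed vertex can be deleted without separating its
neighbours. -/
theorem exists_adj_forall_mem_edgeSpan_deleteIncidenceSet (G : SimpleGraph V) {a b : V}
    (hab : G.Adj a b) :
    ∃ v w, G.Adj v w ∧ ∀ u, G.Adj v u →
      (Pi.single w 1 - Pi.single u 1 : V → ℝ) ∈ edgeSpan (G.deleteIncidenceSet v) := by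
  obtain ⟨v, hv, hmax⟩ := exists_max_image ({x | G.Reachable a x} : Finset V) (G.dist a)
    ⟨a, by simp⟩
  simp only [mem_filter, mem_univ, true_and] at hv hmax
  have hva : v ≠ a := by
    rintro rfl
    have h1 := hmax b hab.reachable
    rw [SimpleGraph.dist_self, SimpleGraph.dist_eq_one_iff_adj.2 hab] at h1
    omega
  -- The predecessor of `u` on a shortest path from `a` is strictly closer to `a`, so by maximality
  -- it is not `v`.
  have key : ∀ n, ∀ u, G.Reachable a u → u ≠ v → G.dist a u = n →
      (Pi.single a 1 - Pi.single u 1 : V → ℝ) ∈ edgeSpan (G.deleteIncidenceSet v) := by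
    intro n
    induction n using Nat.strong_induction_on with
    | _ n ih =>
      intro u hu huv hn
      obtain ⟨p, hp⟩ := hu.symm.exists_walk_length_eq_dist
      cases p with
      | nil => simp
      | @cons _ u' _ h q =>
        rw [SimpleGraph.Walk.length_cons, SimpleGraph.dist_comm, hn] at hp
        have hq := SimpleGraph.dist_le q.reverse
        rw [SimpleGraph.Walk.length_reverse] at hq
        have hu' : u' ≠ v := by
          rintro rfl
          have := hmax u hu
          omega
        have h1 := ih (G.dist a u') (by omega) u' q.reachable.symm hu' rfl
        have h2 : (Pi.single u' 1 - Pi.single u 1 : V → ℝ) ∈ edgeSpan (G.deleteIncidenceSet v) :=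
          single_sub_single_mem_edgeSpan
            (SimpleGraph.deleteIncidenceSet_adj.2 ⟨h.symm, hu', huv⟩)
        simpa using Submodule.add_mem _ h1 h2
  obtain ⟨w, hw⟩ : ∃ w, G.Adj v w := by
    obtain ⟨p⟩ := hv.symm
    cases p with
    | nil => exact absurd rfl hva
    | cons h _ => exact ⟨_, h⟩
  have key' : ∀ u, G.Adj v u →
      (Pi.single a 1 - Pi.single u 1 : V → ℝ) ∈ edgeSpan (G.deleteIncidenceSet v) :=
    fun u hu => key _ u (hv.trans hu.reachable) hu.ne' rfl
  refine ⟨v, w, hw, fun u hu => ?_⟩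
  simpa using Submodule.sub_mem _ (key' u hu) (key' w hw)

/-- The single vector e_v - e_w recovers all edges at `v` modulo the span of the remaining edges. -/
theorem edgeRank_le_edgeRank_deleteIncidenceSet_add_one {G : SimpleGraph V} {v w : V}
    (h : ∀ u, G.Adj v u →
      (Pi.single w 1 - Pi.single u 1 : V → ℝ) ∈ edgeSpan (G.deleteIncidenceSet v)) :
    edgeRank G ≤ edgeRank (G.deleteIncidenceSet v) + 1 := by
  set x : V → ℝ := Pi.single v 1 - Pi.single w 1 with hx
  have hle : edgeSpan G ≤ edgeSpan (G.deleteIncidenceSet v) ⊔ Submodule.span ℝ {x} := by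
    have hv : ∀ u, G.Adj v u → (Pi.single v 1 - Pi.single u 1 : V → ℝ) ∈
        edgeSpan (G.deleteIncidenceSet v) ⊔ Submodule.span ℝ {x} := by
      intro u hu
      have := Submodule.add_mem _ (Submodule.mem_sup_left (T := Submodule.span ℝ {x}) (h u hu))
        (Submodule.mem_sup_right (Submodule.mem_span_singleton_self x))
      simpa [hx] using this
    refine Submodule.span_le.2 ?_
    rintro _ ⟨i, j, hij, rfl⟩
    by_cases hi : i = v
    · subst hi; exact hv j hij
    by_cases hj : j = v
    · subst hj; simpa using Submodule.neg_mem _ (hv i hij.symm)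
    exact Submodule.mem_sup_left (single_sub_single_mem_edgeSpan
      (SimpleGraph.deleteIncidenceSet_adj.2 ⟨hij, hi, hj⟩))
  have h1 := (Submodule.finrank_mono hle).trans (Submodule.finrank_add_le_finrank_add_finrank _ _)
  have h2 : Module.finrank ℝ (Submodule.span ℝ {x}) ≤ 1 := by
    simpa using finrank_span_le_card ({x} : Set (V → ℝ)) (R := ℝ)
  unfold edgeRank
  omega

end

/-! ### Counting sums of two lattice points by their coordinate at a vertex -/

section

open Finset
open scoped Classical

variable {V : Type*} [DecidableEq V]

/-- The number of unordered pairs with one entry in `D` and one entry in `M`. -/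
theorem card_mul_card_le_card_image_sym2 (D M : Finset V) :
    #D * #M ≤ #((D ×ˢ M).image fun p => s(p.1, p.2)) + (#(D ∩ M)).choose 2 := by
  set I := D ∩ M with hI
  set K := (D ×ˢ M) \ (I ×ˢ I) with hK
  have hsub : I ×ˢ I ⊆ D ×ˢ M :=
    product_subset_product inter_subset_left inter_subset_right
  have hKcard : #K + #I * #I = #D * #M := by
    rw [← card_product, ← card_product, card_sdiff_add_card_eq_card hsub]
  -- Two ordered pairs in D × M with the same unordered pair are equal or swapped; swapped pairs
  -- have both entries in `I`, so coincidences occur only in I × I.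
  have hinj : Set.InjOn (fun p : V × V => s(p.1, p.2)) K := by
    rintro ⟨a, b⟩ h1 ⟨c, d⟩ h2 h
    simp only [hK, hI, coe_sdiff, Set.mem_sdiff, mem_coe, mem_product, mem_inter] at h1 h2
    rcases Sym2.eq_iff.1 h with ⟨rfl, rfl⟩ | ⟨rfl, rfl⟩
    · rfl
    · tauto
  have hdisj : Disjoint (K.image fun p => s(p.1, p.2)) I.sym2 := by
    rw [disjoint_left]
    intro s hs hs'
    obtain ⟨⟨a, b⟩, hab, rfl⟩ := mem_image.1 hs
    rw [mk_mem_sym2_iff] at hs'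
    simp only [hK, mem_sdiff, mem_product] at hab
    tauto
  have hle : (K.image fun p => s(p.1, p.2)) ∪ I.sym2 ⊆
      (D ×ˢ M).image fun p => s(p.1, p.2) := by
    refine union_subset (image_subset_image sdiff_subset) ?_
    intro s
    induction s using Sym2.ind with
    | _ a b =>
      intro h
      rw [mk_mem_sym2_iff] at h
      exact mem_image.2 ⟨(a, b), hsub (mem_product.2 h), rfl⟩
  have hcard := card_le_card hle
  rw [card_union_of_disjoint hdisj, card_image_of_injOn hinj, card_sym2] at hcard
  have hc : (#I + 1).choose 2 + (#I).choose 2 = #I * #I := by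
    rw [Nat.choose_succ_succ' _ 1, Nat.choose_one_right]
    have := Nat.triangle_succ (#I)
    rw [Nat.choose_two_right]
    generalize #I = n
    cases n with
    | zero => rfl
    | succ n =>
      have h2 : 2 ∣ (n + 1) * (n + 1 - 1) := (Nat.even_mul_pred_self (n + 1)).two_dvd
      have h3 := Nat.div_mul_cancel h2
      simp only [Nat.add_sub_cancel] at h3 ⊢
      nlinarith
  omega

/-- The vector `e_i + e_j` attached to the unordered pair of `i` and `j`. -/
def pairVec : Sym2 V → V → ℤ :=
  Sym2.lift ⟨fun i j => Pi.single i 1 + Pi.single j 1, fun _ _ => add_comm _ _⟩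

@[simp]
theorem pairVec_mk (i j : V) : pairVec s(i, j) = Pi.single i 1 + Pi.single j 1 := rfl

theorem pairVec_nonneg (s : Sym2 V) (x : V) : 0 ≤ pairVec s x := by
  induction s using Sym2.ind with
  | _ a b =>
    simp only [pairVec_mk, Pi.add_apply, Pi.single_apply]
    split_ifs <;> norm_num

theorem pairVec_eq_zero_of_notMem {s : Sym2 V} {x : V} (h : x ∉ s) : pairVec s x = 0 := by
  induction s using Sym2.ind with
  | _ a b =>
    rw [Sym2.mem_iff, not_or] at h
    simp [h.1, h.2]

theorem pairVec_injective : Function.Injective (pairVec : Sym2 V → V → ℤ) := by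
  have hs : ∀ b d : V, (Pi.single b 1 : V → ℤ) = Pi.single d 1 → b = d := by
    intro b d h
    by_contra hbd
    have := congrFun h b
    simp [hbd] at this
  intro s t h
  induction s, t using Sym2.inductionOn₂ with
  | _ a b c d =>
    rw [pairVec_mk, pairVec_mk] at h
    by_cases hac : a = c
    · subst hac
      rw [hs b d (add_left_cancel h)]
    by_cases had : a = d
    · subst had
      rw [add_comm (Pi.single c 1) _] at h
      rw [hs b c (add_left_cancel h), Sym2.eq_swap]
    have h1 := congrFun h a
    simp only [Pi.add_apply, Pi.single_apply, hac, had, if_true, if_false] at h1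
    split_ifs at h1 <;> norm_num at h1

variable [Fintype V]

/-- The lattice points `0` and `e_i - e_j`, for the edges `ij` of `G`. -/
noncomputable def rootSet (G : SimpleGraph V) : Finset (V → ℤ) :=
  insert 0 (({p | G.Adj p.1 p.2} : Finset (V × V)).image
    fun p => Pi.single p.1 1 - Pi.single p.2 1)

theorem mem_rootSet {G : SimpleGraph V} {x : V → ℤ} :
    x ∈ rootSet G ↔ x = 0 ∨ ∃ i j, G.Adj i j ∧ x = Pi.single i 1 - Pi.single j 1 := by
  simp [rootSet, eq_comm]

theorem zero_mem_rootSet (G : SimpleGraph V) : (0 : V → ℤ) ∈ rootSet G :=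
  mem_rootSet.2 (Or.inl rfl)

theorem single_sub_single_mem_rootSet {G : SimpleGraph V} {i j : V} (h : G.Adj i j) :
    (Pi.single i 1 - Pi.single j 1 : V → ℤ) ∈ rootSet G :=
  mem_rootSet.2 (Or.inr ⟨i, j, h, rfl⟩)

theorem card_rootSet_le (G : SimpleGraph V) : #(rootSet G) ≤ 2 * #G.edgeFinset + 1 := by
  refine (card_insert_le _ _).trans (Nat.add_le_add_right (card_image_le.trans ?_) 1)
  rw [← G.sum_degrees_eq_twice_card_edges, ← univ_product_univ, card_filter, sum_product]
  refine le_of_eq (sum_congr rfl fun x _ => ?_)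
  rw [← card_filter, ← SimpleGraph.card_neighborFinset_eq_degree]
  congr 1; ext; simp

theorem neg_mem_rootSet {G : SimpleGraph V} {x : V → ℤ} (h : x ∈ rootSet G) :
    -x ∈ rootSet G := by
  rcases mem_rootSet.1 h with rfl | ⟨i, j, hij, rfl⟩
  · simpa using h
  · rw [neg_sub]; exact single_sub_single_mem_rootSet hij.symm

/-- Central symmetry: only the levels 0, 1 and 2 need to be counted by hand. -/
theorem card_filter_eq_le_card_filter_eq_neg (G : SimpleGraph V) (v : V) (c : ℤ) :
    #{x ∈ rootSet G + rootSet G | x v = c} ≤ #{x ∈ rootSet G + rootSet G | x v = -c} := by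
  refine card_le_card_of_injOn Neg.neg ?_ neg_injective.injOn
  intro x hx
  simp only [coe_filter, Set.mem_ofPred_eq] at hx ⊢
  obtain ⟨hx, hc⟩ := hx
  obtain ⟨y, hy, z, hz, rfl⟩ := mem_add.1 hx
  refine ⟨?_, by simp [← hc]⟩
  rw [neg_add]
  exact add_mem_add (neg_mem_rootSet hy) (neg_mem_rootSet hz)

theorem card_level_zero (G : SimpleGraph V) (v : V) :
    #(rootSet (G.deleteIncidenceSet v) + rootSet (G.deleteIncidenceSet v)) ≤
      #{x ∈ rootSet G + rootSet G | x v = 0} := by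
  have hsub : rootSet (G.deleteIncidenceSet v) ⊆ rootSet G := by
    intro x hx
    rcases mem_rootSet.1 hx with rfl | ⟨i, j, hij, rfl⟩
    · exact zero_mem_rootSet G
    · exact single_sub_single_mem_rootSet (SimpleGraph.deleteIncidenceSet_le G v hij)
  have hv : ∀ x ∈ rootSet (G.deleteIncidenceSet v), x v = 0 := by
    intro x hx
    rcases mem_rootSet.1 hx with rfl | ⟨i, j, hij, rfl⟩
    · rfl
    · rw [SimpleGraph.deleteIncidenceSet_adj] at hij
      simp [hij.2.1.symm, hij.2.2.symm]
  refine card_le_card fun x hx => ?_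
  obtain ⟨y, hy, z, hz, rfl⟩ := mem_add.1 hx
  exact mem_filter.2 ⟨add_mem_add (hsub hy) (hsub hz), by simp [hv y hy, hv z hz]⟩

/-- The sums counted are 2e_v - e_a - e_b, with a and b neighbours of `v`, possibly equal. -/
theorem card_level_two (G : SimpleGraph V) (v : V) :
    (G.degree v + 1).choose 2 ≤ #{x ∈ rootSet G + rootSet G | x v = 2} := by
  rw [← SimpleGraph.card_neighborFinset_eq_degree, ← card_sym2]
  refine card_le_card_of_injOn (fun s => Pi.single v 2 - pairVec s) ?_
    (fun s _ t _ h => pairVec_injective (sub_right_injective h))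
  intro s
  induction s using Sym2.ind with
  | _ a b =>
    simp only [mem_coe, mk_mem_sym2_iff, SimpleGraph.mem_neighborFinset, mem_filter]
    rintro ⟨ha, hb⟩
    constructor
    · refine mem_add.2 ⟨_, single_sub_single_mem_rootSet ha, _,
        single_sub_single_mem_rootSet hb, ?_⟩
      rw [show (Pi.single v 2 : V → ℤ) = Pi.single v 1 + Pi.single v 1 by
        rw [← Pi.single_add]; rfl, pairVec_mk]
      abel
    · simp [ha.ne, hb.ne]

/-- Two kinds of sums are counted: e_v - e_x, with x a neighbour of `v` or joined in `H` to one, and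
(e_v - e_b) + (e_i - e_a), with a an `H`-neighbour of i and b ≠ i a neighbour of `v`. The second
kind depends only on i and the unordered pair {a, b}. -/
theorem card_level_one (G H : SimpleGraph V) (v : V) (hH : H = G.deleteIncidenceSet v) :
    #(G.neighborFinset v) +
        #{x ∈ (G.neighborFinset v)ᶜ | (H.neighborFinset x ∩ G.neighborFinset v).Nonempty} +
        ∑ i, #((H.neighborFinset i ×ˢ (G.neighborFinset v).erase i).image fun p => s(p.1, p.2)) ≤
      #{x ∈ rootSet G + rootSet G | x v = 1} := by
  set N := G.neighborFinset v with hN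
  set X : Finset V := {x ∈ Nᶜ | (H.neighborFinset x ∩ N).Nonempty} with hX
  have hHadj : ∀ i j, H.Adj i j ↔ G.Adj i j ∧ i ≠ v ∧ j ≠ v := by
    intro i j; rw [hH, SimpleGraph.deleteIncidenceSet_adj]
  have hvN : v ∉ N := by simp [hN]
  have hvX : v ∉ X := by
    intro h
    obtain ⟨y, hy⟩ := (mem_filter.1 h).2
    simp [hHadj] at hy
  have hXN : Disjoint N X := by
    rw [disjoint_left]
    intro x hx hx'
    exact absurd hx (by simpa using (mem_filter.1 hx').1)
  set B : V → Finset (Sym2 V) := fun i =>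
    (H.neighborFinset i ×ˢ N.erase i).image fun p => s(p.1, p.2) with hB
  set F : V → Finset (V → ℤ) := fun i =>
    (B i).image fun s => Pi.single v 1 + Pi.single i 1 - pairVec s with hF
  set F₀ : Finset (V → ℤ) := (N ∪ X).image fun x => Pi.single v 1 - Pi.single x 1 with hF₀
  have hBmem : ∀ i s, s ∈ B i → i ≠ v ∧ i ∉ s ∧ v ∉ s := by
    intro i s hs
    obtain ⟨⟨a, b⟩, hab, rfl⟩ := mem_image.1 hs
    simp only [mem_product, SimpleGraph.mem_neighborFinset, hHadj, mem_erase] at hab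
    obtain ⟨⟨h1, h2, h3⟩, h4, h5⟩ := hab
    refine ⟨h2, ?_, ?_⟩
    · rw [Sym2.mem_iff]; rintro (rfl | rfl)
      · exact h1.ne rfl
      · exact h4 rfl
    · rw [Sym2.mem_iff]; rintro (rfl | rfl)
      · exact h3 rfl
      · exact hvN h5
  -- Apart from `v`, the vertex `i` is the only one with a positive coordinate, so a vector
  -- determines its family `F i`; vectors of `F₀` have no such vertex.
  have hFpos : ∀ i, ∀ x ∈ F i, x i = 1 ∧ i ≠ v := by
    intro i x hx
    obtain ⟨s, hs, rfl⟩ := mem_image.1 hx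
    obtain ⟨h1, h2, h3⟩ := hBmem i s hs
    simp [h1, pairVec_eq_zero_of_notMem h2]
  have hFnonpos : ∀ i j, j ≠ i → j ≠ v → ∀ x ∈ F i, x j ≤ 0 := by
    intro i j hji hjv x hx
    obtain ⟨s, hs, rfl⟩ := mem_image.1 hx
    have := pairVec_nonneg s j
    simpa [hji, hjv] using this
  have hcardF : ∀ i, #(F i) = #(B i) := fun i =>
    card_image_of_injective _ (fun s t h => pairVec_injective (sub_right_injective h))
  have hcardF₀ : #F₀ = #N + #X := by
    rw [hF₀, card_image_of_injective, card_union_of_disjoint hXN]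
    intro x y h
    by_contra hxy
    have := congrFun (sub_right_injective h) x
    simp [hxy] at this
  have hFdisj : (Set.univ : Set V).PairwiseDisjoint F := by
    intro i _ j _ hij
    refine disjoint_left.2 fun x hx hx' => ?_
    have h1 := hFpos i x hx
    have h2 := hFnonpos j i hij h1.2 x hx'
    omega
  have hF₀disj : Disjoint F₀ (univ.biUnion F) := by
    refine disjoint_left.2 fun x hx hx' => ?_
    obtain ⟨i, -, hi⟩ := mem_biUnion.1 hx'
    obtain ⟨h1, h2⟩ := hFpos i x hi
    obtain ⟨y, -, rfl⟩ := mem_image.1 hx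
    simp only [Pi.sub_apply, Pi.single_apply, h2, if_false] at h1
    split_ifs at h1 <;> omega
  have hsub : F₀ ∪ univ.biUnion F ⊆ {x ∈ rootSet G + rootSet G | x v = 1} := by
    refine union_subset ?_ ?_
    · intro z hz
      obtain ⟨x, hx, rfl⟩ := mem_image.1 hz
      have hxv : x ≠ v := by
        rintro rfl
        rcases mem_union.1 hx with h | h
        · exact hvN h
        · exact hvX h
      refine mem_filter.2 ⟨?_, by simp [hxv.symm]⟩
      rcases mem_union.1 hx with h | h
      · rw [← add_zero (Pi.single v 1 - Pi.single x 1)]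
        exact add_mem_add (single_sub_single_mem_rootSet (by simpa [hN] using h))
          (zero_mem_rootSet G)
      · obtain ⟨y, hy⟩ := (mem_filter.1 h).2
        simp only [mem_inter, SimpleGraph.mem_neighborFinset, hHadj, hN] at hy
        refine mem_add.2 ⟨_, single_sub_single_mem_rootSet hy.2, _,
          single_sub_single_mem_rootSet hy.1.1.symm, ?_⟩
        abel
    · intro z hz
      obtain ⟨i, -, hi⟩ := mem_biUnion.1 hz
      obtain ⟨s, hs, rfl⟩ := mem_image.1 hi
      obtain ⟨h1, h2, h3⟩ := hBmem i s hs
      refine mem_filter.2 ⟨?_, by simp [h1.symm, pairVec_eq_zero_of_notMem h3]⟩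
      obtain ⟨⟨a, b⟩, hab, rfl⟩ := mem_image.1 hs
      simp only [mem_product, SimpleGraph.mem_neighborFinset, hHadj, mem_erase, hN] at hab
      refine mem_add.2 ⟨_, single_sub_single_mem_rootSet hab.1.1, _,
        single_sub_single_mem_rootSet hab.2.2, ?_⟩
      rw [pairVec_mk]
      abel
  have := card_le_card hsub
  rw [card_union_of_disjoint hF₀disj, hcardF₀, card_biUnion (fun i _ j _ h => hFdisj
    (Set.mem_univ i) (Set.mem_univ j) h)] at this
  simpa only [hcardF] using this

/-- The growth of the number of sums of two lattice points when a vertex is added. -/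
theorem card_add_le_card_add (G H : SimpleGraph V) (v : V) (hH : H = G.deleteIncidenceSet v) :
    #(rootSet H + rootSet H) + 2 * (G.degree v + 1).choose 2 +
        2 * (G.degree v +
          #{x ∈ (G.neighborFinset v)ᶜ | (H.neighborFinset x ∩ G.neighborFinset v).Nonempty} +
          ∑ i, H.degree i * G.degree v) ≤
      #(rootSet G + rootSet G) +
        2 * (∑ i, (#(H.neighborFinset i ∩ G.neighborFinset v)).choose 2 +
          ∑ i ∈ G.neighborFinset v, H.degree i) := by
  have h0 := card_level_zero G v
  rw [← hH] at h0
  have h1 := card_level_one G H v hH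
  have h1' := card_filter_eq_le_card_filter_eq_neg G v 1
  have h2 := card_level_two G v
  have h2' := card_filter_eq_le_card_filter_eq_neg G v 2
  have hsum := sum_card_fiberwise_eq_card_filter (rootSet G + rootSet G)
    ({0, 1, -1, 2, -2} : Finset ℤ) (fun x => x v)
  have hle := card_filter_le (rootSet G + rootSet G)
    (fun x => x v ∈ ({0, 1, -1, 2, -2} : Finset ℤ))
  rw [← hsum] at hle
  rw [sum_insert (by decide), sum_insert (by decide), sum_insert (by decide),
    sum_insert (by decide), sum_singleton] at hle
  have hB : ∑ i, H.degree i * G.degree v ≤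
      ∑ i, #((H.neighborFinset i ×ˢ (G.neighborFinset v).erase i).image fun p => s(p.1, p.2)) +
      (∑ i, (#(H.neighborFinset i ∩ G.neighborFinset v)).choose 2 +
          ∑ i ∈ G.neighborFinset v, H.degree i) := by
    -- The extra sum over the neighbours of `v` compensates for the erased `i`: there the second
    -- factor is one less than the degree of `v`.
    rw [← sum_ite_mem_eq (G.neighborFinset v), ← sum_add_distrib, ← sum_add_distrib]
    refine sum_le_sum fun i _ => ?_
    have h := card_mul_card_le_card_image_sym2 (H.neighborFinset i)
      ((G.neighborFinset v).erase i)
    have hinter : H.neighborFinset i ∩ (G.neighborFinset v).erase i =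
        H.neighborFinset i ∩ G.neighborFinset v := by
      ext y
      simp only [mem_inter, SimpleGraph.mem_neighborFinset, mem_erase]
      exact ⟨fun h => ⟨h.1, h.2.2⟩, fun h => ⟨h.1, h.1.ne', h.2⟩⟩
    rw [hinter, SimpleGraph.card_neighborFinset_eq_degree, card_erase_eq_ite,
      SimpleGraph.card_neighborFinset_eq_degree] at h
    split_ifs at h ⊢ with hi
    · have hpos : 0 < G.degree v := by
        rw [← SimpleGraph.card_neighborFinset_eq_degree]; exact card_pos.2 ⟨i, hi⟩
      obtain ⟨n, hn⟩ := Nat.exists_eq_add_of_lt hpos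
      rw [hn] at h ⊢
      simp only [zero_add, Nat.add_sub_cancel] at h ⊢
      rw [Nat.mul_succ]
      omega
    · omega
  simp only [SimpleGraph.card_neighborFinset_eq_degree] at h1
  omega

end

/-! ### Numerical inequalities and the induction on edges -/

section

open Finset
open scoped Classical

variable {V : Type*} [DecidableEq V]

/-- In a graph with adjacency indicator `c`, the sum of the squares of the degrees is at most
`e ^ 2 + e` for `e` the number of edges; here `2 * e` is the sum of the degrees. -/
theorem four_mul_sum_sq_le (N : Finset V) (c : V → V → ℤ) (hsymm : ∀ x y, c x y = c y x)
    (hdiag : ∀ x, c x x = 0) (h01 : ∀ x y, c x y = 0 ∨ c x y = 1) :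
    4 * ∑ x ∈ N, (∑ y ∈ N, c x y) ^ 2 ≤
      (∑ x ∈ N, ∑ y ∈ N, c x y) ^ 2 + 2 * ∑ x ∈ N, ∑ y ∈ N, c x y := by
  set a : V → ℤ := fun x => ∑ y ∈ N, c x y with ha
  have hnonneg : ∀ x y, 0 ≤ c x y := fun x y => by rcases h01 x y with h | h <;> simp [h]
  have hpair : ∀ x ∈ N, ∀ y ∈ N, c x y * (2 * (a x + a y)) ≤ c x y * (∑ z ∈ N, a z + 2) := by
    intro x hx y hy
    rcases h01 x y with h | h
    · simp [h]
    have hxy : x ≠ y := by rintro rfl; simp [hdiag] at h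
    -- For an edge xy, deg x + deg y ≤ e + 1. The summands at x and y are replaced by 1, the
    -- contribution of the edge xy itself; any other z contributes at least c z x + c z y.
    have hz : a x + a y ≤ ∑ z ∈ N, (a z + (if z = x then 1 - a x else 0) +
        (if z = y then 1 - a y else 0)) := by
      simp only [ha, ← sum_add_distrib]
      refine sum_le_sum fun z _ => ?_
      by_cases hzx : z = x
      · subst hzx; simp [hdiag, hxy, hsymm y z, h]
      by_cases hzy : z = y
      · subst hzy; simp [hdiag, hzx, h]
      simp only [hzx, hzy, if_false, add_zero]
      rw [hsymm x, hsymm y, ← sum_pair hxy]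
      exact sum_le_sum_of_subset_of_nonneg (by simp [insert_subset_iff, hx, hy])
        (fun w _ _ => hnonneg z w)
    rw [sum_add_distrib, sum_add_distrib, sum_ite_eq' N x, sum_ite_eq' N y, if_pos hx,
      if_pos hy] at hz
    rw [h]
    linarith
  have hsum := sum_le_sum fun x hx => sum_le_sum fun y hy => hpair x hx y hy
  have hR : ∑ x ∈ N, ∑ y ∈ N, c x y * (∑ z ∈ N, a z + 2) =
      (∑ x ∈ N, a x) * (∑ z ∈ N, a z + 2) := by
    simp only [← sum_mul, ha]
  have hL1 : ∑ x ∈ N, ∑ y ∈ N, c x y * (2 * a x) = 2 * ∑ x ∈ N, a x ^ 2 := by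
    rw [mul_sum]
    refine sum_congr rfl fun x _ => ?_
    rw [← sum_mul]; ring
  have hL2 : ∑ x ∈ N, ∑ y ∈ N, c x y * (2 * a y) = 2 * ∑ x ∈ N, a x ^ 2 := by
    rw [← hL1, sum_comm]
    exact sum_congr rfl fun x _ => sum_congr rfl fun y _ => by rw [hsymm]
  simp only [mul_add, sum_add_distrib] at hsum hL1 hL2
  simp only [mul_add, sum_add_distrib] at hR
  linarith

/-- Here n = k - 1, D and Q are the sums of a_i and a_i² over N, S is the sum of a_i - 1 over the x
vertices outside N with a_i ≥ 1, and g is the cyclomatic number of H. Once n ≥ 1, n + 3 ≤ 4n lets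
the term 4ng pay for whatever D + 2S exceeds 2n. -/
theorem extremal_arith {n S D Q g x : ℤ} (hn : 0 ≤ n) (hS : 0 ≤ S) (hD : 0 ≤ D) (hg : 0 ≤ g)
    (hgS : 2 * S + D ≤ 2 * g + 2 * n) (hQ : Q ≤ n * D) (hQ' : 4 * Q ≤ D ^ 2 + 2 * D)
    (hDn : D ≤ n * (n + 1)) (hSx : S ≤ n * x) :
    Q + D + (n + 3) * S ≤ n * (4 * g + n + 3) := by
  obtain rfl | hn1 : n = 0 ∨ 1 ≤ n := by omega
  · simp only [zero_mul] at *; linarith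
  by_cases h : D ≤ 2 * n
  · have h1 : 2 * (Q + D + (n + 3) * S) ≤ (n + 3) * (D + 2 * S) := by nlinarith
    by_cases h2 : D + 2 * S ≤ 2 * n
    · nlinarith
    · nlinarith
  -- For n = 1 the bound D ≤ n(n + 1) gives D ≤ 2n, the previous case.
  · have hn2 : 2 ≤ n := by
      by_contra h'
      obtain rfl : n = 1 := by omega
      omega
    -- Up to D = 3n the quadratic bound on Q is used, beyond it the linear one.
    have h1 : Q + D ≤ n * (n + 3) + 2 * n * (D - 2 * n) := by
      by_cases h3 : D ≤ 3 * n
      · have : (D - 2 * n) * ((D - 2 * n) + 6) ≤ (D - 2 * n) * (4 * n) :=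
          mul_le_mul_of_nonneg_left (by omega) (by omega)
        nlinarith
      · have : (n - 1) * (3 * n) ≤ (n - 1) * D :=
          mul_le_mul_of_nonneg_left (by omega) (by omega)
        nlinarith
    nlinarith

/-- `m`, `r` belong to H and `r'` to G; `A`, `Q'` are the sums of a_i and a_i² outside N; `M'`, `M`
count the sums for H and G. The growth left by `extremal_arith` equals the increment of the claimed
bound when `r'` = `r` + 1. -/
theorem step_arith {k m r r' x A D Q Q' M M' : ℤ} (hk : 1 ≤ k) (hrm : r ≤ m) (hr : r' ≤ r + 1)
    (hD : 0 ≤ D) (hQ : Q ≤ (k - 1) * D) (hQ' : 4 * Q ≤ D ^ 2 + 2 * D)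
    (hDn : D ≤ (k - 1) * ((k - 1) + 1)) (hxA : x ≤ A) (hAx : A ≤ k * x)
    (hQX : Q' + A - 2 * x ≤ (k + 2) * (A - x))
    (hcyc : 2 * r + 2 + D + 2 * A ≤ 2 * m + 2 * k + 2 * x)
    (hM : M' + k ^ 2 + 3 * k + 2 * x + 4 * m * k ≤ M + Q + Q' + D + A)
    (ih : 2 * m ^ 2 + 2 * m + 1 - 2 * (m - r) ^ 2 - 4 * (m - r) ≤ M') :
    2 * (m + k) ^ 2 + 2 * (m + k) + 1 - 2 * (m + k - r') ^ 2 - 4 * (m + k - r') ≤ M := by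
  have key := extremal_arith (n := k - 1) (S := A - x) (D := D) (Q := Q)
    (g := m - r) (x := x) (by linarith) (by linarith) hD (by linarith) (by linarith) hQ
    hQ' hDn (by linarith)
  have hM' : M' + k ^ 2 + 3 * k + 4 * m * k - (k - 1) * (4 * (m - r) + (k - 1) + 3) ≤ M := by
    linarith
  have hg : 0 ≤ (m - r) + (k - 1) := by linarith
  have hgg : (m - r) + (k - 1) ≤ m + k - r' := by linarith
  have hsq := mul_le_mul hgg hgg hg (hg.trans hgg)
  linarith

theorem two_mul_cast_choose_two (n : ℕ) : 2 * ((n.choose 2 : ℕ) : ℤ) = (n : ℤ) ^ 2 - n := by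
  have h := Nat.div_mul_cancel (Nat.even_mul_pred_self n).two_dvd
  rw [← Nat.choose_two_right] at h
  cases n with
  | zero => rfl
  | succ n =>
    rw [Nat.add_sub_cancel] at h
    zify at h
    push_cast
    linarith

variable [Fintype V]

theorem card_edgeFinset_of_eq_deleteIncidenceSet {G H : SimpleGraph V} {v : V}
    (hH : H = G.deleteIncidenceSet v) : #G.edgeFinset = #H.edgeFinset + G.degree v := by
  have h1 := G.card_edgeFinset_deleteIncidenceSet v
  have h2 := G.degree_le_card_edgeFinset v
  have h3 : #H.edgeFinset = #(G.deleteIncidenceSet v).edgeFinset := by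
    subst hH; congr!
  omega

/-- The lower bound for the number of sums of two lattice points is inherited when a vertex is
added that raises the rank by at most one. -/
theorem card_rootSet_add_rootSet_step (G H : SimpleGraph V) (v : V)
    (hH : H = G.deleteIncidenceSet v) (hv : 0 < G.degree v) (hr : edgeRank G ≤ edgeRank H + 1)
    (ih : 2 * (#H.edgeFinset : ℤ) ^ 2 + 2 * #H.edgeFinset + 1 -
      2 * ((#H.edgeFinset : ℤ) - edgeRank H) ^ 2 - 4 * ((#H.edgeFinset : ℤ) - edgeRank H) ≤
        #(rootSet H + rootSet H)) :
    2 * (#G.edgeFinset : ℤ) ^ 2 + 2 * #G.edgeFinset + 1 -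
      2 * ((#G.edgeFinset : ℤ) - edgeRank G) ^ 2 - 4 * ((#G.edgeFinset : ℤ) - edgeRank G) ≤
        #(rootSet G + rootSet G) := by
  have hedges := card_edgeFinset_of_eq_deleteIncidenceSet hH
  have hgrow := card_add_le_card_add G H v hH
  set N := G.neighborFinset v with hN
  have hNcard : #N = G.degree v := G.card_neighborFinset_eq_degree v
  have hcyc := two_mul_edgeRank_le H (card_pos.1 (hNcard ▸ hv))
  have hrank := edgeRank_le_card_edgeFinset H
  have hinter := sum_degree_eq_sum_card_inter H N
  rw [← sum_mul, H.sum_degrees_eq_twice_card_edges, hinter] at hgrow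
  set a : V → ℤ := fun x => (#(H.neighborFinset x ∩ N) : ℤ) with ha
  set c : V → V → ℤ := fun x y => if H.Adj x y then 1 else 0 with hc
  have hac : ∀ x, a x = ∑ y ∈ N, c x y := by
    intro x
    simp only [ha, hc, sum_boole]
    congr 2
    ext y; simp [and_comm]
  set X : Finset V := {x ∈ Nᶜ | (H.neighborFinset x ∩ N).Nonempty} with hX
  have hXcard : (#X : ℤ) = ∑ x ∈ Nᶜ, if (H.neighborFinset x ∩ N).Nonempty then 1 else 0 := by
    rw [sum_boole]
  have ha0 : ∀ x, 0 ≤ a x := fun x => Int.natCast_nonneg _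
  have hak : ∀ x, a x ≤ G.degree v := by
    intro x
    have : #(H.neighborFinset x ∩ N) ≤ #N := card_le_card inter_subset_right
    simp only [ha]
    omega
  have hak' : ∀ x ∈ N, a x ≤ G.degree v - 1 := by
    intro x hx
    have : #(H.neighborFinset x ∩ N) < #N := by
      refine card_lt_card ⟨inter_subset_right, fun h => ?_⟩
      have := (mem_inter.1 (h hx)).1
      simp at this
    rw [hNcard] at this
    simp only [ha]
    omega
  have hsq : 4 * ∑ x ∈ N, a x ^ 2 ≤ (∑ x ∈ N, a x) ^ 2 + 2 * ∑ x ∈ N, a x := by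
    simp only [hac]
    refine four_mul_sum_sq_le N c ?_ ?_ ?_
    · intro x y; simp [hc, H.adj_comm]
    · intro x; simp [hc]
    · intro x y; simp only [hc]; split_ifs <;> simp
  have hQn : ∑ x ∈ N, a x ^ 2 ≤ ((G.degree v : ℤ) - 1) * ∑ x ∈ N, a x := by
    rw [mul_sum]
    refine sum_le_sum fun x hx => ?_
    rw [sq]
    exact mul_le_mul_of_nonneg_right (hak' x hx) (ha0 x)
  have hDn : ∑ x ∈ N, a x ≤ ((G.degree v : ℤ) - 1) * ((G.degree v - 1) + 1) := by
    refine (sum_le_card_nsmul N a _ hak').trans (le_of_eq ?_)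
    rw [hNcard, nsmul_eq_mul]; ring
  have hpt : ∀ x, (if (H.neighborFinset x ∩ N).Nonempty then (1 : ℤ) else 0) = 0 ∧ a x = 0 ∨
      (if (H.neighborFinset x ∩ N).Nonempty then (1 : ℤ) else 0) = 1 ∧ 1 ≤ a x := by
    intro x
    split_ifs with h
    · refine Or.inr ⟨rfl, ?_⟩
      have := card_pos.2 h
      simp only [ha]; omega
    · refine Or.inl ⟨rfl, ?_⟩
      simp [ha, not_nonempty_iff_eq_empty.1 h]
  have hS0 : (#X : ℤ) ≤ ∑ x ∈ Nᶜ, a x := by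
    rw [hXcard]
    refine sum_le_sum fun x _ => ?_
    rcases hpt x with ⟨h1, h2⟩ | ⟨h1, h2⟩ <;> rw [h1] <;> linarith
  have hSx : ∑ x ∈ Nᶜ, a x ≤ G.degree v * #X := by
    rw [hXcard, mul_sum]
    refine sum_le_sum fun x _ => ?_
    have := hak x
    rcases hpt x with ⟨h1, h2⟩ | ⟨h1, h2⟩ <;> rw [h1] <;> linarith
  have hQX : ∑ x ∈ Nᶜ, a x ^ 2 + ∑ x ∈ Nᶜ, a x - 2 * #X ≤
      ((G.degree v : ℤ) + 2) * (∑ x ∈ Nᶜ, a x - #X) := by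
    rw [hXcard, mul_sum, ← sum_sub_distrib, ← sum_add_distrib, ← sum_sub_distrib, mul_sum]
    refine sum_le_sum fun x _ => ?_
    have := hak x
    rcases hpt x with ⟨h1, h2⟩ | ⟨h1, h2⟩ <;> rw [h1]
    · rw [h2]; norm_num
    -- a² + a - 2 = (a + 2)(a - 1), with 1 ≤ a ≤ k.
    · nlinarith
  have hchoose : 2 * ((∑ i, (#(H.neighborFinset i ∩ N)).choose 2 : ℕ) : ℤ) =
      ∑ x ∈ N, a x ^ 2 + ∑ x ∈ Nᶜ, a x ^ 2 - (∑ x ∈ N, a x + ∑ x ∈ Nᶜ, a x) := by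
    rw [sum_add_sum_compl, sum_add_sum_compl, ← sum_sub_distrib, Nat.cast_sum, mul_sum]
    exact sum_congr rfl fun x _ => two_mul_cast_choose_two _
  have hchoose' := two_mul_cast_choose_two (G.degree v + 1)
  rw [← sum_add_sum_compl N (fun x => #(H.neighborFinset x ∩ N))] at hgrow
  have hDcast : ((∑ x ∈ N, #(H.neighborFinset x ∩ N) : ℕ) : ℤ) = ∑ x ∈ N, a x := by
    rw [Nat.cast_sum]
  have hAcast : ((∑ x ∈ Nᶜ, #(H.neighborFinset x ∩ N) : ℕ) : ℤ) = ∑ x ∈ Nᶜ, a x := by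
    rw [Nat.cast_sum]
  have hD0 : 0 ≤ ∑ x ∈ N, a x := sum_nonneg fun x _ => ha0 x
  rw [hNcard] at hcyc
  zify at hcyc hgrow hrank hr
  push_cast at hcyc hgrow hchoose' hDcast hAcast
  rw [hDcast, hAcast] at hcyc hgrow
  rw [hedges]
  push_cast
  have h1 : (1 : ℤ) ≤ G.degree v := by exact_mod_cast hv
  clear_value a c
  refine step_arith h1 hrank hr hD0 hQn hsq hDn hS0 hSx hQX ?_ ?_ ih
  · exact hcyc
  · push_cast at hchoose
    linarith

/-- A lower bound for the number of sums of two lattice points of the symmetric edge polytope. -/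
theorem le_card_rootSet_add_rootSet (G : SimpleGraph V) :
    2 * (#G.edgeFinset : ℤ) ^ 2 + 2 * #G.edgeFinset + 1 -
      2 * ((#G.edgeFinset : ℤ) - edgeRank G) ^ 2 - 4 * ((#G.edgeFinset : ℤ) - edgeRank G) ≤
        #(rootSet G + rootSet G) := by
  induction hm : #G.edgeFinset using Nat.strong_induction_on generalizing G with
  | _ m ih =>
    by_cases hG : ∃ a b, G.Adj a b
    · obtain ⟨a, b, hab⟩ := hG
      obtain ⟨v, w, hvw, h⟩ := exists_adj_forall_mem_edgeSpan_deleteIncidenceSet G hab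
      have hdeg : 0 < G.degree v := (G.degree_pos_iff_exists_adj v).2 ⟨w, hvw⟩
      obtain ⟨H, hH⟩ : ∃ H, H = G.deleteIncidenceSet v := ⟨_, rfl⟩
      have hlt : #H.edgeFinset < m := by
        have := card_edgeFinset_of_eq_deleteIncidenceSet hH
        omega
      rw [← hm]
      refine card_rootSet_add_rootSet_step G H v hH hdeg ?_ (ih _ hlt _ rfl)
      rw [hH]
      exact edgeRank_le_edgeRank_deleteIncidenceSet_add_one h
    · have hm0 : m = 0 := by
        rw [← hm, card_eq_zero, SimpleGraph.edgeFinset_eq_empty]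
        ext x y
        simpa using fun h => hG ⟨x, y, h⟩
      have hr := edgeRank_le_card_edgeFinset G
      have hpos : 0 < #(rootSet G + rootSet G) :=
        card_pos.2 ⟨0 + 0, add_mem_add (zero_mem_rootSet G) (zero_mem_rootSet G)⟩
      have hr0 : edgeRank G = 0 := by omega
      rw [hm0, hr0]
      have hpos' : (1 : ℤ) ≤ #(rootSet G + rootSet G) := by exact_mod_cast hpos
      push_cast
      linarith

end

/-! ### Lattice points, dimension and the formula for γ_2 -/

section

open Finset

variable {V : Type*} [DecidableEq V]

theorem le_of_mem_symmetricEdgePolytope {G : SimpleGraph V} (φ : (V → ℝ) →ₗ[ℝ] ℝ) {c : ℝ}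
    (h : ∀ i j, G.Adj i j → φ (Pi.single i 1 - Pi.single j 1) ≤ c) {x : V → ℝ}
    (hx : x ∈ symmetricEdgePolytope G) : φ x ≤ c := by
  have hsub : symmetricEdgePolytope G ⊆ {y | φ y ≤ c} := by
    refine convexHull_min ?_ (convex_halfSpace_le φ.isLinear c)
    rintro _ ⟨i, j, hij, rfl⟩
    exact h i j hij
  exact hsub hx

theorem single_sub_single_mem_symmetricEdgePolytope {G : SimpleGraph V} {i j : V}
    (h : G.Adj i j) : (Pi.single i 1 - Pi.single j 1 : V → ℝ) ∈ symmetricEdgePolytope G :=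
  subset_convexHull ℝ _ ⟨i, j, h, rfl⟩

theorem zero_mem_symmetricEdgePolytope {G : SimpleGraph V} {i j : V} (h : G.Adj i j) :
    (0 : V → ℝ) ∈ symmetricEdgePolytope G := by
  have := (convex_convexHull ℝ _).midpoint_mem (single_sub_single_mem_symmetricEdgePolytope h)
    (single_sub_single_mem_symmetricEdgePolytope h.symm)
  rwa [← neg_sub (Pi.single i 1) (Pi.single j 1), midpoint_self_neg] at this

theorem apply_le_one_of_mem_symmetricEdgePolytope {G : SimpleGraph V} {x : V → ℝ}
    (hx : x ∈ symmetricEdgePolytope G) (v : V) : x v ≤ 1 := by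
  refine le_of_mem_symmetricEdgePolytope (LinearMap.proj v) ?_ hx
  intro i j _
  simp only [LinearMap.proj_apply, Pi.sub_apply, Pi.single_apply]
  split_ifs <;> norm_num

theorem neg_one_le_apply_of_mem_symmetricEdgePolytope {G : SimpleGraph V} {x : V → ℝ}
    (hx : x ∈ symmetricEdgePolytope G) (v : V) : -1 ≤ x v := by
  have := le_of_mem_symmetricEdgePolytope (-LinearMap.proj v) (c := 1) ?_ hx
  · simp only [LinearMap.neg_apply, LinearMap.proj_apply] at this
    linarith
  intro i j _
  simp only [LinearMap.neg_apply, LinearMap.proj_apply, Pi.sub_apply, Pi.single_apply]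
  split_ifs <;> norm_num

theorem ehrhartCount_zero {G : SimpleGraph V} {a b : V} (hab : G.Adj a b) :
    ehrhartCount (symmetricEdgePolytope G) 0 = 1 := by
  have h0 : ((0 : ℕ) : ℝ) • symmetricEdgePolytope G = {0} := by
    rw [Nat.cast_zero, Set.zero_smul_set ⟨0, zero_mem_symmetricEdgePolytope hab⟩]
    rfl
  rw [ehrhartCount, Nat.card_eq_one_iff_unique]
  constructor
  · refine ⟨fun ⟨x, hx⟩ ⟨y, hy⟩ => Subtype.ext (funext fun v => ?_)⟩
    rw [h0, Set.mem_singleton_iff] at hx hy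
    have := congrFun (hx.trans hy.symm) v
    exact_mod_cast this
  · exact ⟨⟨0, by rw [h0, Set.mem_singleton_iff]; ext; simp⟩⟩

variable [Fintype V]

theorem sum_eq_zero_of_mem_symmetricEdgePolytope {G : SimpleGraph V} {x : V → ℝ}
    (hx : x ∈ symmetricEdgePolytope G) : ∑ v, x v = 0 := by
  set φ : (V → ℝ) →ₗ[ℝ] ℝ := ∑ v, LinearMap.proj v with hφ
  have hval : ∀ y, φ y = ∑ v, y v := fun y => by simp [hφ]
  have h1 := le_of_mem_symmetricEdgePolytope φ (c := 0) (fun i j _ => by simp [hval]) hx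
  have h2 := le_of_mem_symmetricEdgePolytope (-φ) (c := 0) (fun i j _ => by simp [hval]) hx
  rw [LinearMap.neg_apply] at h2
  rw [← hval]
  linarith

/-- The lattice points of the symmetric edge polytope. -/
theorem mem_rootSet_of_cast_mem {G : SimpleGraph V} {x : V → ℤ}
    (hx : (fun v => (x v : ℝ)) ∈ symmetricEdgePolytope G) : x ∈ rootSet G := by
  by_cases hx0 : x = 0
  · exact mem_rootSet.2 (Or.inl hx0)
  have hsum : ∑ v, x v = 0 := by
    have := sum_eq_zero_of_mem_symmetricEdgePolytope hx
    exact_mod_cast this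
  obtain ⟨w, hw⟩ : ∃ w, x w ≠ 0 := by
    by_contra! h
    exact hx0 (funext h)
  obtain ⟨i, -, hi⟩ := exists_pos_of_sum_zero_of_exists_nonzero x hsum ⟨w, mem_univ w, hw⟩
  obtain ⟨j, -, hj⟩ := exists_pos_of_sum_zero_of_exists_nonzero (fun v => -x v) (by simp [hsum])
    ⟨w, mem_univ w, by simpa using hw⟩
  have hij : i ≠ j := by rintro rfl; omega
  have hup : ∀ v, x v ≤ 1 := fun v => by
    exact_mod_cast apply_le_one_of_mem_symmetricEdgePolytope hx v
  have hlow : ∀ v, -1 ≤ x v := fun v => by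
    exact_mod_cast neg_one_le_apply_of_mem_symmetricEdgePolytope hx v
  have hxi : x i = 1 := by have := hup i; omega
  have hxj : x j = -1 := by have := hlow j; omega
  -- The functional x_i - x_j takes the value 2 at `x`, but is at most 1 on every generator other
  -- than e_i - e_j.
  have hadj : G.Adj i j := by
    by_contra hnot
    have := le_of_mem_symmetricEdgePolytope
      ((LinearMap.proj i : (V → ℝ) →ₗ[ℝ] ℝ) - LinearMap.proj j) (c := 1) ?_ hx
    · simp only [LinearMap.sub_apply, LinearMap.proj_apply, hxi, hxj] at this
      norm_num at this
    intro k l hkl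
    have hne := hkl.ne
    simp only [LinearMap.sub_apply, LinearMap.proj_apply, Pi.sub_apply, Pi.single_apply]
    split_ifs <;> first | (norm_num; done) | (subst_vars; contradiction)
  refine mem_rootSet.2 (Or.inr ⟨i, j, hadj, funext fun k => ?_⟩)
  by_cases hki : k = i
  · subst hki; simp [hxi, hij]
  by_cases hkj : k = j
  · subst hkj; simp [hxj, hki]
  -- Both x_i - x_j + x_k and x_i - x_j - x_k are at most 2 on the polytope; as x_i - x_j = 2, this
  -- forces x_k = 0.
  have h1 := le_of_mem_symmetricEdgePolytope
    ((LinearMap.proj i : (V → ℝ) →ₗ[ℝ] ℝ) - LinearMap.proj j + LinearMap.proj k) (c := 2) (fun a b _ => by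
      simp only [LinearMap.sub_apply, LinearMap.add_apply, LinearMap.proj_apply, Pi.sub_apply,
        Pi.single_apply]
      split_ifs <;> first | (norm_num; done) | (subst_vars; contradiction)) hx
  have h2 := le_of_mem_symmetricEdgePolytope
    ((LinearMap.proj i : (V → ℝ) →ₗ[ℝ] ℝ) - LinearMap.proj j - LinearMap.proj k) (c := 2) (fun a b _ => by
      simp only [LinearMap.sub_apply, LinearMap.proj_apply, Pi.sub_apply, Pi.single_apply]
      split_ifs <;> first | (norm_num; done) | (subst_vars; contradiction)) hx
  simp only [LinearMap.sub_apply, LinearMap.add_apply, LinearMap.proj_apply, hxi, hxj] at h1 h2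
  norm_cast at h1 h2
  simp only [Pi.sub_apply, Pi.single_apply, hki, hkj, if_false]
  omega

theorem cast_mem_of_mem_rootSet {G : SimpleGraph V} {a b : V} (hab : G.Adj a b) {x : V → ℤ}
    (hx : x ∈ rootSet G) : (fun v => (x v : ℝ)) ∈ symmetricEdgePolytope G := by
  rcases mem_rootSet.1 hx with rfl | ⟨i, j, hij, rfl⟩
  · convert zero_mem_symmetricEdgePolytope hab
    simp
  · convert single_sub_single_mem_symmetricEdgePolytope hij using 1
    ext v
    simp [Pi.single_apply]

theorem ehrhartCount_one_le (G : SimpleGraph V) :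
    ehrhartCount (symmetricEdgePolytope G) 1 ≤ #(rootSet G) := by
  rw [ehrhartCount, ← Nat.card_eq_finsetCard]
  refine Nat.card_le_card_of_injective (fun x => ⟨x.1, mem_rootSet_of_cast_mem ?_⟩)
    (fun _ _ h => Subtype.ext (Subtype.mk.inj h))
  simpa using x.2

theorem card_le_ehrhartCount_two {G : SimpleGraph V} {a b : V} (hab : G.Adj a b) :
    #(rootSet G + rootSet G) ≤ ehrhartCount (symmetricEdgePolytope G) 2 := by
  -- `Nat.card` of an infinite type is 0, so a lower bound needs boundedness.
  have hfin : Finite {x : V → ℤ //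
      (fun v => (x v : ℝ)) ∈ ((2 : ℕ) : ℝ) • symmetricEdgePolytope G} := by
    refine Set.Finite.to_subtype (s := {x : V → ℤ | (fun v => (x v : ℝ)) ∈
      ((2 : ℕ) : ℝ) • symmetricEdgePolytope G}) ?_
    refine (Set.finite_Icc (fun _ => -2 : V → ℤ) (fun _ => 2)).subset ?_
    intro x hx
    obtain ⟨y, hy, hxy⟩ := Set.mem_smul_set.1 hx
    have hv : ∀ v, (x v : ℝ) = 2 * y v := fun v => by
      simpa using (congrFun hxy v).symm
    constructor <;> intro v
    · have h1 := neg_one_le_apply_of_mem_symmetricEdgePolytope hy v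
      have h2 : ((-2 : ℤ) : ℝ) ≤ x v := by rw [hv]; push_cast; linarith
      exact_mod_cast h2
    · have h1 := apply_le_one_of_mem_symmetricEdgePolytope hy v
      have h2 : (x v : ℝ) ≤ ((2 : ℤ) : ℝ) := by rw [hv]; push_cast; linarith
      exact_mod_cast h2
  have hmem : ∀ x ∈ rootSet G + rootSet G,
      (fun v => (x v : ℝ)) ∈ ((2 : ℕ) : ℝ) • symmetricEdgePolytope G := by
    intro x hx
    obtain ⟨y, hy, z, hz, rfl⟩ := mem_add.1 hx
    refine Set.mem_smul_set.2 ⟨_, (convex_convexHull ℝ _).midpoint_mem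
      (cast_mem_of_mem_rootSet hab hy) (cast_mem_of_mem_rootSet hab hz), ?_⟩
    ext v
    simp [midpoint_eq_smul_add]
    ring
  rw [← Nat.card_eq_finsetCard]
  exact Nat.card_le_card_of_injective
    (fun x : (rootSet G + rootSet G : Finset _) => ⟨x.1, hmem x.1 x.2⟩)
    (fun _ _ h => Subtype.ext (Subtype.mk.inj h))

/-- This inequality suffices, since a dimension below the rank only improves the final estimate. -/
theorem polytopeDim_le_edgeRank (G : SimpleGraph V) :
    polytopeDim (symmetricEdgePolytope G) ≤ edgeRank G := by
  refine Submodule.finrank_mono (Submodule.span_le.2 ?_)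
  have hsub : symmetricEdgePolytope G ⊆ edgeSpan G :=
    convexHull_min Submodule.subset_span (edgeSpan G).convex
  rintro _ ⟨x, hx, y, hy, rfl⟩
  exact Submodule.sub_mem _ (hsub hx) (hsub hy)

theorem coeff_one_sub_X_pow_mul (n : ℕ) (f : PowerSeries ℤ) :
    PowerSeries.coeff 0 ((1 - PowerSeries.X) ^ n * f) = PowerSeries.coeff 0 f ∧
    PowerSeries.coeff 1 ((1 - PowerSeries.X) ^ n * f) =
      PowerSeries.coeff 1 f - n * PowerSeries.coeff 0 f ∧
    PowerSeries.coeff 2 ((1 - PowerSeries.X) ^ n * f) =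
      PowerSeries.coeff 2 f - n * PowerSeries.coeff 1 f + n.choose 2 * PowerSeries.coeff 0 f := by
  induction n with
  | zero => simp
  | succ n ih =>
    obtain ⟨h0, h1, h2⟩ := ih
    have h : (1 - PowerSeries.X) ^ (n + 1) * f =
        (1 - PowerSeries.X) ^ n * f - PowerSeries.X * ((1 - PowerSeries.X) ^ n * f) := by ring
    rw [h, map_sub, map_sub, map_sub, PowerSeries.coeff_zero_X_mul,
      PowerSeries.coeff_succ_X_mul 0, PowerSeries.coeff_succ_X_mul 1, h0, h1, h2,
      Nat.choose_succ_succ' n 1, Nat.choose_one_right]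
    push_cast
    refine ⟨by ring, by ring, by ring⟩

/-- The coefficient of L(1) is negative, so an upper bound for L(1) and a lower bound for L(2) are
what is needed. -/
theorem gammaVec_two_eq {V : Type*} {P : Set (V → ℝ)} (h4 : 4 ≤ polytopeDim P)
    (h0 : ehrhartCount P 0 = 1) :
    gammaVec P 2 = ehrhartCount P 2 - (2 * polytopeDim P - 1) * ehrhartCount P 1 +
      2 * (polytopeDim P : ℤ) ^ 2 - 2 * polytopeDim P - 2 := by
  obtain ⟨c0, c1, c2⟩ := coeff_one_sub_X_pow_mul (polytopeDim P + 1)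
    (PowerSeries.mk fun k => (ehrhartCount P k : ℤ))
  simp only [PowerSeries.coeff_mk, h0] at c0 c1 c2
  have g0 : gammaOf (polytopeDim P) (hStar P) 0 = 1 := by
    rw [gammaOf, if_pos (by omega)]
    simpa [hStar, hStarSeries] using c0
  have g1 : gammaOf (polytopeDim P) (hStar P) 1 =
      ehrhartCount P 1 - 2 * polytopeDim P - 1 := by
    rw [gammaOf, if_pos (by omega), Fin.sum_univ_one]
    simp only [hStar, hStarSeries, c1, Fin.val_zero, g0]
    simp
    ring
  rw [gammaVec, gammaOf, if_pos (by omega), Fin.sum_univ_two]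
  simp only [hStar, hStarSeries, c2, Fin.val_zero, Fin.val_one, mul_zero, mul_one, Nat.sub_zero]
  have hc1 := two_mul_cast_choose_two (polytopeDim P + 1)
  have hc2 := two_mul_cast_choose_two (polytopeDim P)
  push_cast at hc1
  rw [show (gammaOf (polytopeDim P) (hStar P) 0) = 1 from g0,
    show (gammaOf (polytopeDim P) (hStar P) 1) = _ from g1]
  push_cast [Nat.cast_sub (show 2 ≤ polytopeDim P by omega)]
  simp only [Nat.choose_one_right]
  push_cast [Nat.cast_sub (show 2 ≤ polytopeDim P by omega)]
  linarith

end

theorem mainTheorem1 {V : Type*} [Fintype V] [DecidableEq V] (G : SimpleGraph V) :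
    0 ≤ gammaVec (symmetricEdgePolytope G) 2 := by
  classical
  by_cases h4 : 4 ≤ polytopeDim (symmetricEdgePolytope G)
  swap
  · rw [gammaVec, gammaOf, if_neg (by omega)]
  obtain ⟨a, b, hab⟩ : ∃ a b, G.Adj a b := by
    by_contra! h
    have hempty : symmetricEdgePolytope G = ∅ := by
      rw [symmetricEdgePolytope, convexHull_eq_empty, Set.eq_empty_iff_forall_notMem]
      rintro x ⟨i, j, hij, -⟩
      exact h i j hij
    rw [hempty, polytopeDim, vectorSpan_empty, finrank_bot] at h4
    omega
  rw [gammaVec_two_eq h4 (ehrhartCount_zero hab)]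
  have h1 := (ehrhartCount_one_le G).trans (card_rootSet_le G)
  have h2 := card_le_ehrhartCount_two hab
  have hcore := le_card_rootSet_add_rootSet G
  have hd := polytopeDim_le_edgeRank G
  have hr := edgeRank_le_card_edgeFinset G
  generalize polytopeDim (symmetricEdgePolytope G) = d at *
  generalize ehrhartCount (symmetricEdgePolytope G) 1 = L₁ at *
  generalize ehrhartCount (symmetricEdgePolytope G) 2 = L₂ at *
  generalize edgeRank G = r at *
  zify at h1 h2 hd hr h4
  have h3 := mul_le_mul_of_nonneg_left h1 (show (0 : ℤ) ≤ 2 * d - 1 by linarith)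
  -- What remains is 2(m - r)² + 4(m - r) ≤ 2(m - d)² + 4(m - d), true as d ≤ r ≤ m; the hint is the
  -- cross term of (m - d)² = ((m - r) + (r - d))².
  nlinarith [mul_nonneg (sub_nonneg.2 hd) (sub_nonneg.2 hr)]
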